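/- Let $K\ge 1$ and $1\le L\le N$ be integers and $M\le N$ a real number. Consider the following caching problem with private demands. A server holds a library of $N$ files $F_1,\dots,F_N$ of $B$ i.i.d. uniform bits each and is connected to $K$ users by an error-free broadcast link; the demand of user $k$ is a vector $\mathbf d_k=(d_{k,1}<\dots<d_{k,L})$ of $L$ file indices, and $\mathbb D=(\mathbf d_1,\dots,\mathbf d_K)$. A scheme consists of: random cache metadata $(\mathscr M(C_1),\dots,\mathscr M(C_K))$; cached contents $C_k=\phi_k(F_1,\dots,F_N,\mathscr M(C_k))$, so that user $k$ stores $Z_k=(\mathscr M(C_k),C_k)$; and a broadcast packet $X=(\mathscr M(P),P)$, where the packet metadata $\mathscr M(P)$ is a function of $\mathbb D$, $Z_1,\dots,Z_K$ and randomness local to the server, and the payload is $P=\psi(F_1,\dots,F_N,\mathscr M(P))$. All alphabets are finite, and library, cache metadata, server randomness and $\mathbb D$ are independent. Entropies $H$ and mutual informations $I$ are in bits. A pair $(M,R)$ is called achievable if for every $\varepsilon>0$ and every $B_0$ there are some $B\ge B_0$ and a scheme for files of $B$ bits such that * (decodability) $H(F_{d_{k,1}},\dots,F_{d_{k,L}}\mid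 X,Z_k,\mathbf d_k)=0$ for every user $k$ and every law of $\mathbb D$; * (privacy) $I\big((\mathbf d_j)_{j\ne k};X,Z_k\mid \mathbf d_k\big)=0$ for every user $k$ and every law of $\mathbb D$; * (memory and load) $H(C_k)\le MB$ for every $k$, and $H(P)\le RB$ for each fixed value of $\mathbb D$; * (negligible metadata) $H(\mathscr M(C_k))\le\varepsilon B$ for every $k$, and $H(\mathscr M(P))\le \varepsilon B$ for each fixed value of $\mathbb D$. Let $R^\star$ be the infimum of all $R$ such that $(M,R)$ is achievable, and let $R_{\mathrm m}$ be the value at $M$ of the lower convex envelope of the points $(0,N)$, $\left(\frac{2K-1}{2K}N,\frac{L}{2K}\right)$ and $$\left(N\frac{2^{K-1}}{D_t},\; L\,\frac{2^K-\sum_{j=0}^{t}\binom Kj}{D_t}\right),\qquad D_t=2^{K-1}+\sum_{j=t}^{K-1}\binom{K-1}{j},\qquad t=0,1,\dots,K.$$ If $M\ge\min\left\{\frac{2K-1}{2K},\frac{2^{K-1}}{2^{K-1}+1}\right\}N$, then the set of achievable $R$ is non-empty and bounded below, and $$R^\star=R_{\mathrm m}=L\left(1-\frac MN\right).$$ -/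

import Mathlib

namespace PrivateCaching

noncomputable section

/-! ### Shannon entropy of discrete random variables, in bits

A random variable is a function `X : Ω → α` on a discrete probability space `(Ω, P)`. -/

/-- The entropy `H(X) = - ∑ₐ P(X = a) log₂ P(X = a)`. -/
def entropy {Ω α : Type*} [Fintype α] (P : PMF Ω) (X : Ω → α) : ℝ :=
  ∑ a, Real.negMulLog ((P.map X) a).toReal / Real.log 2

/-- The conditional entropy `H(X | Y) = H(X, Y) - H(Y)`. -/
def condEntropy {Ω α β : Type*} [Fintype α] [Fintype β] (P : PMF Ω)
    (X : Ω → α) (Y : Ω → β) : ℝ :=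
  entropy P (fun ω => (X ω, Y ω)) - entropy P Y

/-- The conditional mutual information `I(X ; Y | W) = H(X | W) - H(X | Y, W)`. -/
def condMutualInfo {Ω α β γ : Type*} [Fintype α] [Fintype β] [Fintype γ] (P : PMF Ω)
    (X : Ω → α) (Y : Ω → β) (W : Ω → γ) : ℝ :=
  condEntropy P X W - condEntropy P X (fun ω => (Y ω, W ω))

/-! ### The system model -/

/-- A library of `N` files of `B` bits each. -/
abbrev Library (N B : ℕ) : Type := Fin N → Fin B → Bool

/-- The demand vector of one user: `d₁ < d₂ < ⋯ < d_L` in the set of the `N` file indices. -/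
abbrev DemandVector (N L : ℕ) : Type := {d : Fin L → Fin N // StrictMono d}

/-- A demand matrix: one demand vector for each of the `K` users. -/
abbrev DemandMatrix (K N L : ℕ) : Type := Fin K → DemandVector N L

/-- A two-phase scheme for `K` users, `N` files of `B` bits and `L` requested files per user
(no constraint is imposed yet).  In the placement phase the cache metadata of all users are drawn
(jointly) from `placementLaw`, and user `k` stores its metadata and the content computed from the
library and its own metadata.  In the delivery phase the server, given the demand matrix, all
caches (metadata and content) and some randomness of its own, chooses the metadata of the packet
that it broadcasts; the payload of the packet is computed from the library and this metadata. -/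
structure Scheme (K N L B : ℕ) where
  /-- the alphabet of the cache metadata of user `k` -/
  CacheMeta : Fin K → Type
  /-- the alphabet of the cached content of user `k` -/
  Cache : Fin K → Type
  /-- the alphabet of the randomness of the server in the delivery phase -/
  Rand : Type
  /-- the alphabet of the packet metadata -/
  PacketMeta : Type
  /-- the alphabet of the payload -/
  Payload : Type
  [fintypeCacheMeta : ∀ k, Fintype (CacheMeta k)]
  [fintypeCache : ∀ k, Fintype (Cache k)]
  [fintypeRand : Fintype Rand]
  [fintypePacketMeta : Fintype PacketMeta]
  [fintypePayload : Fintype Payload]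
  placementLaw : PMF (∀ k, CacheMeta k)
  randLaw : PMF Rand
  cacheContent : ∀ k, Library N B → CacheMeta k → Cache k
  packetMeta : DemandMatrix K N L → (∀ k, CacheMeta k × Cache k) → Rand → PacketMeta
  payload : Library N B → PacketMeta → Payload

attribute [instance] Scheme.fintypeCacheMeta Scheme.fintypeCache Scheme.fintypeRand
  Scheme.fintypePacketMeta Scheme.fintypePayload

namespace Scheme

variable {K N L B : ℕ} (s : Scheme K N L B)

/-- An outcome: the library, all cache metadata, the server randomness and the demand matrix. -/
structure Outcome where
  library : Library N B
  cacheMeta : ∀ k, s.CacheMeta k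
  rand : s.Rand
  demand : DemandMatrix K N L

/-- The joint law when the demand matrix has law `Q`: the library consists of `N * B` i.i.d. fair
bits, and library, cache metadata, server randomness and demands are independent. -/
def law (Q : PMF (DemandMatrix K N L)) : PMF s.Outcome :=
  (PMF.uniformOfFintype (Library N B)).bind fun F =>
    s.placementLaw.bind fun m =>
      s.randLaw.bind fun T =>
        Q.map fun D => ⟨F, m, T, D⟩

/-- The cached content `C_k`. -/
def C (k : Fin K) (ω : s.Outcome) : s.Cache k := s.cacheContent k ω.library (ω.cacheMeta k)

/-- The full cache `Z_k`: metadata together with content. -/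
def Z (k : Fin K) (ω : s.Outcome) : s.CacheMeta k × s.Cache k := (ω.cacheMeta k, s.C k ω)

/-- The metadata of the broadcast packet. -/
def MP (ω : s.Outcome) : s.PacketMeta := s.packetMeta ω.demand (fun k => s.Z k ω) ω.rand

/-- The payload `P` of the broadcast packet. -/
def P (ω : s.Outcome) : s.Payload := s.payload ω.library (s.MP ω)

/-- The broadcast packet `X`: metadata together with payload. -/
def X (ω : s.Outcome) : s.PacketMeta × s.Payload := (s.MP ω, s.P ω)

/-- The demand vector of user `k`. -/
def d (k : Fin K) (ω : s.Outcome) : DemandVector N L := ω.demand k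

/-- The demand vectors of all users but `k`. -/
def otherDemands (k : Fin K) (ω : s.Outcome) : {j : Fin K // j ≠ k} → DemandVector N L :=
  fun j => ω.demand j

/-- The files requested by user `k`. -/
def requestedFiles (k : Fin K) (ω : s.Outcome) : Fin L → Fin B → Bool :=
  fun l => ω.library ((s.d k ω).1 l)

/-- Decodability, `H({F_i : i ∈ d_k} | X, Z_k, d_k) = 0`, whatever the law of the demands. -/
def Decodable : Prop :=
  ∀ (Q : PMF (DemandMatrix K N L)) (k : Fin K),
    condEntropy (s.law Q) (s.requestedFiles k) (fun ω => (s.X ω, s.Z k ω, s.d k ω)) = 0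

/-- Privacy, `I(D_{∖k} ; X, Z_k | d_k) = 0`, whatever the law of the demands. -/
def Private : Prop :=
  ∀ (Q : PMF (DemandMatrix K N L)) (k : Fin K),
    condMutualInfo (s.law Q) (s.otherDemands k) (fun ω => (s.X ω, s.Z k ω)) (s.d k) = 0

/-- The cached contents satisfy `H(C_k) ≤ M B` (which does not involve the demands). -/
def MemoryAtMost (M : ℝ) : Prop :=
  ∀ (D : DemandMatrix K N L) (k : Fin K), entropy (s.law (PMF.pure D)) (s.C k) ≤ M * B

/-- For every demand matrix the payload satisfies `H(P) ≤ R B`. -/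
def LoadAtMost (R : ℝ) : Prop :=
  ∀ D : DemandMatrix K N L, entropy (s.law (PMF.pure D)) s.P ≤ R * B

/-- All metadata have entropy at most `ε B`, for every demand matrix. -/
def MetadataAtMost (ε : ℝ) : Prop :=
  ∀ D : DemandMatrix K N L,
    (∀ k : Fin K, entropy (s.law (PMF.pure D)) (fun ω => ω.cacheMeta k) ≤ ε * B) ∧
      entropy (s.law (PMF.pure D)) s.MP ≤ ε * B

end Scheme

/-- The memory-load pair `(M, R)` is achievable: there are decodable and private schemes of memory
at most `M` and load at most `R`, of arbitrarily large file length `B`, whose metadata are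
negligible compared to `B`. -/
def Achievable (K N L : ℕ) (M R : ℝ) : Prop :=
  ∀ ε > (0 : ℝ), ∀ B₀ : ℕ, ∃ B ≥ B₀, ∃ s : Scheme K N L B,
    s.Decodable ∧ s.Private ∧ s.MemoryAtMost M ∧ s.LoadAtMost R ∧ s.MetadataAtMost ε

/-- The optimal private load `R*`. -/
def optimalLoad (K N L : ℕ) (M : ℝ) : ℝ := sInf {R : ℝ | Achievable K N L M R}

/-! ### The load of the MDS-based scheme -/

/-- The lower convex envelope of a set of points of the plane. -/
def lowerConvexEnvelope (S : Set (ℝ × ℝ)) (x : ℝ) : ℝ :=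
  sInf {y : ℝ | (x, y) ∈ convexHull ℝ S}

/-- `2^(K-1) + C(K-1,t) + C(K-1,t+1) + ⋯ + C(K-1,K-1)`, for `K ≥ 1`. -/
def mdsPieces (K t : ℕ) : ℕ :=
  2 ^ (K - 1) + ∑ j ∈ Finset.Icc t (K - 1), (K - 1).choose j

/-- The memory-load pair with parameter `t`. -/
def mdsPoint (K N L t : ℕ) : ℝ × ℝ :=
  ((N : ℝ) * (2 ^ (K - 1) / (mdsPieces K t : ℝ)),
    (L : ℝ) * ((2 ^ K - ∑ j ∈ Finset.range (t + 1), (K.choose j : ℝ)) / (mdsPieces K t : ℝ)))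

/-- The memory-load pairs of the MDS-based scheme, together with `(0, N)`. -/
def mdsPoints (K N L : ℕ) : Set (ℝ × ℝ) :=
  {((0 : ℝ), (N : ℝ))} ∪ {p | ∃ t ≤ K, p = mdsPoint K N L t} ∪
    {((2 * (K : ℝ) - 1) / (2 * K) * N, (L : ℝ) / (2 * K))}

/-- The load `R_m` of the MDS-based scheme with memory `M`. -/
def mdsLoad (K N L : ℕ) (M : ℝ) : ℝ := lowerConvexEnvelope (mdsPoints K N L) M

end

end PrivateCaching

/-! Both bounds meet on the line `L (1 - M / N)`, which is also the last segment of the envelope.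

Converse. Fix one user. The joint entropy of a set of files and its cache is a submodular function
of the set, so some `L` files carry, given the cache, at least the fraction `L / N` of the
conditional entropy of the whole library, which is at least `(N - M) B` up to metadata. If exactly
these files are demanded, decodability forces the packet to supply that much
(`Scheme.load_lower_bound`).

Achievability, already for `M ≥ K / (K + 1) * N`. Let `μ = 1 - M / N ≤ 1 / (K + 1)`. Each file has
`K + 1` field symbols `x₀, …, x_K` of about `μ B` bits; the remaining bits are cached by everyone.
User `k` caches all `x_j` with `j ≠ 0, k`, and `x₀ + w x_k` with a secret random bit `w` for each
file. The server publishes the bits `u_k`, equal to `w` flipped exactly when user `k` requests the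
file, and the masked sum `x₀ + ∑ u_k x_k` of a file is known to user `k` if the file is not
requested, and completes the file if it is. So each user lacks only `L` of the `N` masked sums, and
`L` Vandermonde combinations of them serve all users at once. The published bits are one-time pads
of the demands, whence privacy.

Envelope. All the generating points lie on or above the line, and `(N, 0)` and the two points whose
memories appear in the hypothesis lie on it (`mdsLoad_eq`). -/

namespace PrivateCaching

/-! ### Entropy inequalities and conditional independence. -/

section Entropy

variable {Ω α β γ : Type*}

/-- The probability of `X = a`, as a real number. -/
noncomputable def prob (P : PMF Ω) (X : Ω → α) (a : α) : ℝ := (P.map X a).toReal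

lemma prob_nonneg (P : PMF Ω) (X : Ω → α) (a : α) : 0 ≤ prob P X a := ENNReal.toReal_nonneg

lemma sum_prob [Fintype α] (P : PMF Ω) (X : Ω → α) : ∑ a, prob P X a = 1 := by
  unfold prob
  rw [← ENNReal.toReal_sum (fun a _ => PMF.apply_ne_top _ _), ← tsum_fintype (L := .unconditional _),
    PMF.tsum_coe, ENNReal.toReal_one]

open Classical in
lemma prob_comp [Fintype α] (P : PMF Ω) (X : Ω → α) (f : α → β) (b : β) :
    prob P (fun ω => f (X ω)) b = ∑ a, if f a = b then prob P X a else 0 := by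
  unfold prob
  have h : P.map (fun ω => f (X ω)) = (P.map X).map f := by
    rw [PMF.map_comp]; rfl
  rw [h, PMF.map_apply, tsum_fintype, ENNReal.toReal_sum]
  · refine Finset.sum_congr rfl fun a _ => ?_
    by_cases hb : f a = b
    · simp [hb]
    · simp [hb, Ne.symm hb]
  · intro a _
    split_ifs
    · exact PMF.apply_ne_top _ _
    · simp

lemma prob_le_prob_comp [Fintype α] (P : PMF Ω) (X : Ω → α) (f : α → β) (a : α) :
    prob P X a ≤ prob P (fun ω => f (X ω)) (f a) := by
  classical
  rw [prob_comp P X f]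
  calc prob P X a = if f a = f a then prob P X a else 0 := by simp
    _ ≤ _ := Finset.single_le_sum (f := fun x => if f x = f a then prob P X x else 0)
      (fun x _ => by split_ifs <;> simp [prob_nonneg]) (Finset.mem_univ a)

lemma sum_prob_fst [Fintype α] [Fintype β] (P : PMF Ω) (X : Ω → α) (Y : Ω → β) (b : β) :
    ∑ a, prob P (fun ω => (X ω, Y ω)) (a, b) = prob P Y b := by
  classical
  have h := prob_comp P (fun ω => (X ω, Y ω)) Prod.snd b
  simp only [Fintype.sum_prod_type, Finset.sum_ite_eq', Finset.mem_univ, if_true] at h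
  exact h.symm

/-- Entropies of several functions of `X` become sums over the same index set, so they can be
compared term by term. -/
lemma entropy_comp [Fintype α] [Fintype β] (P : PMF Ω) (X : Ω → α) (f : α → β) :
    entropy P (fun ω => f (X ω)) =
      (∑ a, prob P X a * -Real.log (prob P (fun ω => f (X ω)) (f a))) / Real.log 2 := by
  classical
  rw [entropy, ← Finset.sum_div]
  congr 1
  have h : ∀ b, Real.negMulLog ((P.map (fun ω => f (X ω)) b).toReal) =
      ∑ a, if f a = b then prob P X a * -Real.log (prob P (fun ω => f (X ω)) (f a)) else 0 := by
    intro b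
    change Real.negMulLog (prob P (fun ω => f (X ω)) b) = _
    rw [Real.negMulLog, neg_mul_comm]
    nth_rw 1 [prob_comp]
    rw [Finset.sum_mul]
    refine Finset.sum_congr rfl fun a _ => ?_
    split_ifs with hab
    · rw [hab]
    · simp
  simp_rw [h]
  rw [Finset.sum_comm]
  simp

lemma entropy_eq_sum [Fintype α] (P : PMF Ω) (X : Ω → α) :
    entropy P X = (∑ a, prob P X a * -Real.log (prob P X a)) / Real.log 2 :=
  entropy_comp P X id

lemma entropy_map [Fintype β] (P : PMF Ω) (X : Ω → α) (f : α → β) :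
    entropy (P.map X) f = entropy P (fun ω => f (X ω)) := by
  simp only [entropy, PMF.map_comp]; rfl

lemma entropy_comp_le [Fintype α] [Fintype β] (P : PMF Ω) (X : Ω → α) (f : α → β) :
    entropy P (fun ω => f (X ω)) ≤ entropy P X := by
  rw [entropy_comp, entropy_eq_sum]
  refine div_le_div_of_nonneg_right (Finset.sum_le_sum fun a _ => ?_) (Real.log_nonneg one_le_two)
  rcases (prob_nonneg P X a).eq_or_lt with h | h
  · simp [← h]
  · exact mul_le_mul_of_nonneg_left
      (neg_le_neg (Real.log_le_log h (prob_le_prob_comp P X f a))) h.le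

lemma entropy_le_of_determines [Fintype α] [Fintype β] (P : PMF Ω) (X : Ω → α) (Y : Ω → β)
    (h : ∀ ω ω', X ω = X ω' → Y ω = Y ω') : entropy P Y ≤ entropy P X := by
  obtain ⟨ω₀, -⟩ := P.support_nonempty
  have : Nonempty β := ⟨Y ω₀⟩
  obtain ⟨f, rfl⟩ : ∃ f : α → β, Y = f ∘ X :=
    (Function.factorsThrough_iff Y).1 fun ω ω' hω => h ω ω' hω
  exact entropy_comp_le P X f

lemma entropy_const [Fintype α] (P : PMF Ω) (a : α) : entropy P (fun _ => a) = 0 := by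
  classical
  have h : P.map (fun _ => a) = PMF.pure a := PMF.map_const P a
  rw [entropy]
  refine Finset.sum_eq_zero fun b _ => ?_
  rw [h, PMF.pure_apply]
  split_ifs <;> simp

lemma entropy_nonneg [Fintype α] (P : PMF Ω) (X : Ω → α) : 0 ≤ entropy P X :=
  (entropy_const P ()).symm.le.trans (entropy_le_of_determines P X _ fun _ _ _ => rfl)

lemma condEntropy_eq_zero_of_determines [Fintype α] [Fintype β] (P : PMF Ω) (X : Ω → α)
    (Y : Ω → β) (h : ∀ ω ω', Y ω = Y ω' → X ω = X ω') : condEntropy P X Y = 0 := by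
  refine sub_eq_zero.2 (le_antisymm ?_ ?_)
  · exact entropy_le_of_determines P _ _ fun ω ω' hω => Prod.ext (h ω ω' hω) hω
  · exact entropy_le_of_determines P _ _ fun ω ω' hω => (Prod.ext_iff.1 hω).2

/-- Strong subadditivity of entropy. -/
lemma entropy_submodular [Fintype α] [Fintype β] [Fintype γ] (P : PMF Ω) (X : Ω → α)
    (Y : Ω → β) (W : Ω → γ) :
    entropy P (fun ω => (X ω, Y ω, W ω)) + entropy P W ≤
      entropy P (fun ω => (X ω, W ω)) + entropy P (fun ω => (Y ω, W ω)) := by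
  have hlog : 0 < Real.log 2 := Real.log_pos one_lt_two
  set T : Ω → α × β × γ := fun ω => (X ω, Y ω, W ω) with hT
  have eW := entropy_comp P T (fun t => t.2.2)
  have eXW := entropy_comp P T (fun t => (t.1, t.2.2))
  have eYW := entropy_comp P T (fun t => t.2)
  have eT := entropy_eq_sum P T
  simp only [hT] at eW eXW eYW
  rw [eT, eW, eXW, eYW, ← add_div, ← add_div]
  refine div_le_div_of_nonneg_right ?_ hlog.le
  rw [← Finset.sum_add_distrib, ← Finset.sum_add_distrib]
  -- The law under which `X` and `Y` are conditionally independent given `W`. The inequality is the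
  -- nonnegativity of the relative entropy of the true law with respect to `r`, obtained from `log z
  -- ≤ z - 1` at `z = r / p`.
  set r : α × β × γ → ℝ := fun t =>
    prob P (fun ω => (X ω, W ω)) (t.1, t.2.2) * prob P (fun ω => (Y ω, W ω)) t.2 /
      prob P W t.2.2 with hr
  have hrsum : ∑ t, r t = 1 := by
    rw [← sum_prob P W]
    simp only [hr, Fintype.sum_prod_type]
    rw [Finset.sum_comm]
    simp_rw [Finset.sum_comm (s := (Finset.univ : Finset α)) (t := (Finset.univ : Finset γ))]
    rw [Finset.sum_comm]
    refine Finset.sum_congr rfl fun w _ => ?_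
    have h1 : ∀ y, ∑ x, prob P (fun ω => (X ω, W ω)) (x, w) * prob P (fun ω => (Y ω, W ω)) (y, w) /
        prob P W w = prob P (fun ω => (Y ω, W ω)) (y, w) * (prob P W w / prob P W w) := by
      intro y
      rw [← Finset.sum_div, ← Finset.sum_mul, sum_prob_fst, mul_comm, mul_div_assoc]
    simp_rw [h1]
    -- Since `0 / 0 = 0`, the identity `p * p / p = p` also covers values of `W` of probability
    -- zero.
    rw [← Finset.sum_mul, sum_prob_fst, ← mul_div_assoc, mul_self_div_self]
  have key : ∀ t ∈ Finset.univ, prob P T t * -Real.log (prob P T t)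
        + prob P T t * -Real.log (prob P W t.2.2) + prob P T t ≤
      prob P T t * -Real.log (prob P (fun ω => (X ω, W ω)) (t.1, t.2.2))
        + prob P T t * -Real.log (prob P (fun ω => (Y ω, W ω)) t.2) + r t := by
    intro t _
    have h1 := prob_le_prob_comp P T (fun t => t.2.2) t
    have h2 := prob_le_prob_comp P T (fun t => (t.1, t.2.2)) t
    have h3 := prob_le_prob_comp P T (fun t => t.2) t
    simp only [hT] at h1 h2 h3
    rcases (prob_nonneg P T t).eq_or_lt with h | h
    · have : 0 ≤ r t := div_nonneg (mul_nonneg (prob_nonneg _ _ _) (prob_nonneg _ _ _))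
        (prob_nonneg _ _ _)
      simpa [← h] using this
    · have p1 := h.trans_le h1
      have p2 := h.trans_le h2
      have p3 := h.trans_le h3
      have hl := Real.log_le_sub_one_of_pos (div_pos (div_pos (mul_pos p2 p3) p1) h)
      rw [Real.log_div (div_pos (mul_pos p2 p3) p1).ne' h.ne',
        Real.log_div (mul_pos p2 p3).ne' p1.ne', Real.log_mul p2.ne' p3.ne'] at hl
      have := mul_le_mul_of_nonneg_left hl h.le
      have e : prob P T t * (r t / prob P T t - 1) = r t - prob P T t := by
        field_simp
      change _ ≤ prob P T t * (r t / prob P T t - 1) at this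
      rw [e] at this
      linarith
  have := Finset.sum_le_sum key
  rw [Finset.sum_add_distrib, Finset.sum_add_distrib (g := r), hrsum, sum_prob] at this
  linarith

lemma entropy_prod_le [Fintype α] [Fintype β] (P : PMF Ω) (X : Ω → α) (Y : Ω → β) :
    entropy P (fun ω => (X ω, Y ω)) ≤ entropy P X + entropy P Y := by
  have h := entropy_submodular P X Y (fun _ => ())
  have h1 := entropy_le_of_determines P (fun ω => (X ω, Y ω, ())) (fun ω => (X ω, Y ω))
    (by simp +contextual)
  have h2 := entropy_le_of_determines P X (fun ω => (X ω, ())) (by simp +contextual)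
  have h3 := entropy_le_of_determines P Y (fun ω => (Y ω, ())) (by simp +contextual)
  linarith [entropy_nonneg P (fun _ => ())]

/-- The uniform distribution maximises entropy. -/
lemma entropy_le_logb_card [Fintype α] (P : PMF Ω) (X : Ω → α) :
    entropy P X ≤ Real.logb 2 (Fintype.card α) := by
  obtain ⟨ω₀, -⟩ := P.support_nonempty
  have : Nonempty α := ⟨X ω₀⟩
  have hc : (0 : ℝ) < Fintype.card α := by exact_mod_cast Fintype.card_pos
  rw [entropy_eq_sum, Real.logb]
  refine div_le_div_of_nonneg_right ?_ (Real.log_nonneg one_le_two)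
  have key : ∀ a ∈ Finset.univ, prob P X a * -Real.log (prob P X a) ≤
      (prob P X a * Real.log (Fintype.card α) + ((Fintype.card α : ℝ)⁻¹ - prob P X a)) := by
    intro a _
    rcases (prob_nonneg P X a).eq_or_lt with h | h
    · simp [← h]
    · have hl := Real.log_le_sub_one_of_pos (inv_pos.2 (mul_pos hc h))
      rw [Real.log_inv, Real.log_mul hc.ne' h.ne'] at hl
      have := mul_le_mul_of_nonneg_left hl h.le
      have e : prob P X a * ((Fintype.card α * prob P X a)⁻¹ - 1) =
          (Fintype.card α : ℝ)⁻¹ - prob P X a := by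
        field_simp
      rw [e] at this
      linarith
  refine (Finset.sum_le_sum key).trans ?_
  rw [Finset.sum_add_distrib, Finset.sum_sub_distrib, ← Finset.sum_mul, sum_prob]
  simp [hc.ne']

lemma entropy_uniformOfFintype [Fintype α] [Nonempty α] :
    entropy (PMF.uniformOfFintype α) (fun a => a) = Real.logb 2 (Fintype.card α) := by
  have hc : (Fintype.card α : ℝ) ≠ 0 := by exact_mod_cast Fintype.card_ne_zero
  have h : ∀ a : α, ((PMF.uniformOfFintype α).map (fun a => a) a).toReal =
      (Fintype.card α : ℝ)⁻¹ := by
    intro a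
    change ((PMF.uniformOfFintype α).map id a).toReal = _
    simp [PMF.map_id]
  simp only [entropy, h, Real.negMulLog, Real.logb, Real.log_inv]
  simp
  field_simp

/-- Conditionally independent variables have conditional mutual information zero. -/
lemma condMutualInfo_eq_zero [Fintype α] [Fintype β] [Fintype γ] (P : PMF Ω) (X : Ω → α)
    (Y : Ω → β) (W : Ω → γ)
    (h : ∀ x y w, prob P (fun ω => (X ω, Y ω, W ω)) (x, y, w) * prob P W w =
      prob P (fun ω => (X ω, W ω)) (x, w) * prob P (fun ω => (Y ω, W ω)) (y, w)) :
    condMutualInfo P X Y W = 0 := by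
  set T : Ω → α × β × γ := fun ω => (X ω, Y ω, W ω) with hT
  have eW := entropy_comp P T (fun t => t.2.2)
  have eXW := entropy_comp P T (fun t => (t.1, t.2.2))
  have eYW := entropy_comp P T (fun t => t.2)
  have eT := entropy_eq_sum P T
  simp only [hT] at eW eXW eYW eT
  rw [condMutualInfo, condEntropy, condEntropy, eT, eW, eXW, eYW, ← sub_div, ← sub_div, ← sub_div]
  refine div_eq_zero_iff.2 (Or.inl ?_)
  rw [← Finset.sum_sub_distrib, ← Finset.sum_sub_distrib, ← Finset.sum_sub_distrib]
  refine Finset.sum_eq_zero fun t _ => ?_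
  have h1 := prob_le_prob_comp P T (fun t => t.2.2) t
  have h2 := prob_le_prob_comp P T (fun t => (t.1, t.2.2)) t
  have h3 := prob_le_prob_comp P T (fun t => t.2) t
  simp only [hT] at h1 h2 h3
  rcases (prob_nonneg P T t).eq_or_lt with h0 | h0
  · simp only [hT] at h0
    simp [← h0]
  · simp only [hT] at h0
    have hl := congrArg Real.log (h t.1 t.2.1 t.2.2)
    rw [Real.log_mul h0.ne' (h0.trans_le h1).ne', Real.log_mul (h0.trans_le h2).ne'
      (h0.trans_le h3).ne'] at hl
    have hl' : ∀ z : ℝ, z * Real.log (prob P (fun ω => (X ω, Y ω, W ω)) t) +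
        z * Real.log (prob P W t.2.2) = z * Real.log (prob P (fun ω => (X ω, W ω)) (t.1, t.2.2)) +
        z * Real.log (prob P (fun ω => (Y ω, W ω)) t.2) := fun z => by
      rw [← mul_add, ← mul_add]; exact congrArg _ hl
    linarith [hl' (prob P (fun ω => (X ω, Y ω, W ω)) t)]

/-- The kernel `κ` producing `Y` sees `D` only through `W = g D`, so the joint law factors as the
law of `(X, W)` times `κ`. This is the form in which privacy is checked. -/
lemma condMutualInfo_eq_zero_of_kernel {δ : Type*} [Fintype α] [Fintype β] [Fintype γ] (P : PMF Ω)
    (X : Ω → α) (Y : Ω → β) (W : Ω → γ) (Q : PMF δ) (a : δ → α) (g : δ → γ) (κ : γ → PMF β)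
    (h : P.map (fun ω => (X ω, Y ω, W ω)) =
      Q.bind fun D => (κ (g D)).map fun y => (a D, y, g D)) :
    condMutualInfo P X Y W = 0 := by
  classical
  have hQ : P.map (fun ω => (X ω, Y ω, W ω)) = (Q.map fun D => (a D, g D)).bind
      fun p => (κ p.2).map fun y => (p.1, y, p.2) := by
    rw [h, PMF.bind_map]; rfl
  have joint : ∀ x y w, prob P (fun ω => (X ω, Y ω, W ω)) (x, y, w) =
      prob Q (fun D => (a D, g D)) (x, w) * (κ w y).toReal := by
    intro x y w
    rw [prob, prob, hQ, ← ENNReal.toReal_mul, PMF.bind_apply, tsum_eq_single (x, w),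
      PMF.map_apply (fun y => (x, y, w)), tsum_eq_single y]
    · simp
    · intro y' hy
      simp [hy.symm]
    · rintro ⟨x', w'⟩ hne
      refine mul_eq_zero_of_right _ ?_
      rw [PMF.map_apply, ENNReal.tsum_eq_zero]
      intro y'
      refine if_neg fun he => hne ?_
      simp only [Prod.mk.injEq] at he ⊢
      exact ⟨he.1.symm, he.2.2.symm⟩
  have hκ : ∀ w, ∑ y, (κ w y).toReal = 1 := fun w => by
    have := sum_prob (κ w) id
    simpa only [prob, PMF.map_id] using this
  have hYW : ∀ y w, prob P (fun ω => (Y ω, W ω)) (y, w) =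
      (∑ x, prob Q (fun D => (a D, g D)) (x, w)) * (κ w y).toReal := by
    intro y w
    rw [← sum_prob_fst P X (fun ω => (Y ω, W ω)) (y, w), Finset.sum_mul]
    exact Finset.sum_congr rfl fun x _ => joint x y w
  have hW : ∀ w, prob P W w = ∑ x, prob Q (fun D => (a D, g D)) (x, w) := by
    intro w
    rw [← sum_prob_fst P Y W w]
    simp_rw [hYW]
    rw [← Finset.mul_sum, hκ, mul_one]
  have hXW : ∀ x w, prob P (fun ω => (X ω, W ω)) (x, w) =
      prob Q (fun D => (a D, g D)) (x, w) := by
    intro x w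
    have := prob_comp P (fun ω => (X ω, Y ω, W ω)) (fun t => (t.1, t.2.2)) (x, w)
    rw [this]
    simp only [Fintype.sum_prod_type, joint, Prod.mk.injEq, ite_and]
    rw [Finset.sum_eq_single x (fun x' _ hx => by simp [hx]) (by simp)]
    simp [← Finset.mul_sum, hκ]
  refine condMutualInfo_eq_zero P X Y W fun x y w => ?_
  rw [joint, hW, hXW, hYW]
  ring

end Entropy

/-! ### Converse: the lower bound on the load. -/

section Converse

/-- A submodular function increases on some set of `L` elements by at least the fraction `L / N`
of its total increase. -/
lemma exists_card_eq_mul_sub_le {N L : ℕ} (hN : 0 < N) (hLN : L ≤ N) (f : Finset (Fin N) → ℝ)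
    (hf : ∀ T S i, T ⊆ S → f (insert i S) - f S ≤ f (insert i T) - f T) :
    ∃ S : Finset (Fin N), S.card = L ∧
      (L : ℝ) * (f Finset.univ - f ∅) ≤ (N : ℝ) * (f S - f ∅) := by
  have : NeZero N := ⟨hN.ne'⟩
  set g : ℕ → ℝ := fun j => f (Finset.univ.filter fun x => x.val < j) with hg
  set Δ : Fin N → ℝ := fun i => g (i + 1) - g i with hΔ
  have htotal : ∑ i, Δ i = f Finset.univ - f ∅ := by
    simp only [hΔ]
    rw [Fin.sum_univ_eq_sum_range (fun i => g (i + 1) - g i) N, Finset.sum_range_sub]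
    simp [hg]
  -- `Δ i` is the gain of adding `i` to all smaller indices. When `S` is built in increasing order,
  -- `i` is added to a subset of these, so its gain is at least `Δ i`.
  have hle : ∀ S : Finset (Fin N), ∑ i ∈ S, Δ i ≤ f S - f ∅ := by
    intro S
    induction S using Finset.induction_on_max with
    | empty => simp
    | insert a s hs ih =>
      rw [Finset.sum_insert fun h => lt_irrefl _ (hs a h)]
      have hins : insert a (Finset.univ.filter fun x : Fin N => x.val < a.val) =
          Finset.univ.filter fun x : Fin N => x.val < a.val + 1 := by
        ext x
        simp only [Finset.mem_insert, Finset.mem_filter, Finset.mem_univ, true_and, Fin.ext_iff]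
        omega
      have := hf s (Finset.univ.filter fun x : Fin N => x.val < a.val) a fun x hx => by
        simpa using hs x hx
      rw [hins] at this
      simp only [hΔ, hg]
      simp only [hΔ, hg] at ih
      linarith
  -- Cyclic windows of `L` consecutive indices modulo `N`: each index lies in exactly `L` of the `N`
  -- windows, so some window has at least the average sum of the `Δ i`.
  set w : Fin N → Fin L → Fin N := fun a l => a + Fin.castLE hLN l with hw
  have hinj : ∀ a, Function.Injective (w a) := fun a =>
    (add_right_injective a).comp (Fin.castLE_injective hLN)
  have hsum : ∑ a, ∑ l, Δ (w a l) = L * ∑ i, Δ i := by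
    rw [Finset.sum_comm]
    have : ∀ l, ∑ a, Δ (w a l) = ∑ i, Δ i := fun l =>
      Equiv.sum_comp (Equiv.addRight (Fin.castLE hLN l)) Δ
    simp [this]
  obtain ⟨a, -, ha⟩ : ∃ a ∈ (Finset.univ : Finset (Fin N)),
      (L : ℝ) * ∑ i, Δ i / N ≤ ∑ l, Δ (w a l) := by
    refine Finset.exists_le_of_sum_le Finset.univ_nonempty ?_
    rw [hsum, ← Finset.sum_div]
    simp
    field_simp
    exact le_refl _
  refine ⟨Finset.univ.map ⟨w a, hinj a⟩, by simp, ?_⟩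
  have h1 := hle (Finset.univ.map ⟨w a, hinj a⟩)
  rw [Finset.sum_map] at h1
  simp only [Function.Embedding.coeFn_mk] at h1
  rw [← Finset.sum_div, htotal] at ha
  have hN' : (0 : ℝ) < N := by exact_mod_cast hN
  have h2 := mul_le_mul_of_nonneg_left (ha.trans h1) hN'.le
  calc _ = (N : ℝ) * (L * ((f Finset.univ - f ∅) / N)) := by field_simp
    _ ≤ _ := h2

/-- Conditioning reduces the entropy increment of a family of random variables. -/
lemma entropy_insert_sub_le {Ω ι α γ : Type*} [Fintype α] [Fintype γ] [DecidableEq ι]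
    (P : PMF Ω) (F : Ω → ι → α) (Z : Ω → γ) (T S : Finset ι) (i : ι) (hTS : T ⊆ S) :
    entropy P (fun ω => (fun j : (insert i S : Finset ι) => F ω j, Z ω)) -
        entropy P (fun ω => (fun j : S => F ω j, Z ω)) ≤
      entropy P (fun ω => (fun j : (insert i T : Finset ι) => F ω j, Z ω)) -
        entropy P (fun ω => (fun j : T => F ω j, Z ω)) := by
  have h := entropy_submodular P (fun ω => F ω i) (fun ω (j : S) => F ω j)
    (fun ω => (fun j : T => F ω j, Z ω))
  have h1 := entropy_le_of_determines P
    (fun ω => (F ω i, (fun j : S => F ω j), (fun j : T => F ω j), Z ω))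
    (fun ω => (fun j : (insert i S : Finset ι) => F ω j, Z ω)) (by
      intro ω ω' he
      simp only [Prod.mk.injEq, funext_iff, Subtype.forall, Finset.mem_insert] at he ⊢
      refine ⟨?_, he.2.2.2⟩
      rintro j (rfl | hj)
      · exact he.1
      · exact he.2.1 j hj)
  have h2 := entropy_le_of_determines P
    (fun ω => (fun j : (insert i T : Finset ι) => F ω j, Z ω))
    (fun ω => (F ω i, (fun j : T => F ω j), Z ω)) (by
      intro ω ω' he
      simp only [Prod.mk.injEq, funext_iff, Subtype.forall, Finset.mem_insert] at he ⊢
      exact ⟨he.1 i (Or.inl rfl), fun j hj => he.1 j (Or.inr hj), he.2⟩)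
  have h3 := entropy_le_of_determines P
    (fun ω => (fun j : S => F ω j, Z ω))
    (fun ω => ((fun j : S => F ω j), (fun j : T => F ω j), Z ω)) (by
      intro ω ω' he
      simp only [Prod.mk.injEq, funext_iff, Subtype.forall] at he ⊢
      exact ⟨he.1, fun j hj => he.1 j (hTS hj), he.2⟩)
  linarith

namespace Scheme

variable {K N L B : ℕ} (s : Scheme K N L B)

/-- The joint law of the library, the cache metadata and the server randomness. -/
noncomputable def baseLaw : PMF (Library N B × (∀ k, s.CacheMeta k) × s.Rand) :=
  (PMF.uniformOfFintype (Library N B)).bind fun F =>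
    s.placementLaw.bind fun m => s.randLaw.map fun T => (F, m, T)

/-- The outcome with demand matrix `D`. -/
def outcome (D : DemandMatrix K N L) (p : Library N B × (∀ k, s.CacheMeta k) × s.Rand) :
    s.Outcome := ⟨p.1, p.2.1, p.2.2, D⟩

/-- Drawing the demands first reduces a point-mass `Q` to the base law, and exhibits the general law
as a mixture over `D`, as the privacy proof needs. -/
lemma law_eq_bind (Q : PMF (DemandMatrix K N L)) :
    s.law Q = Q.bind fun D => s.baseLaw.map (s.outcome D) := by
  simp only [baseLaw, PMF.map_bind, PMF.map_comp]
  rw [PMF.bind_comm, law]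
  refine congrArg _ (funext fun F => ?_)
  conv_rhs => rw [PMF.bind_comm]
  refine congrArg _ (funext fun m => ?_)
  simp only [← PMF.bind_pure_comp]
  rw [PMF.bind_comm]
  rfl

lemma law_pure (D : DemandMatrix K N L) : s.law (PMF.pure D) = s.baseLaw.map (s.outcome D) := by
  rw [law_eq_bind, PMF.pure_bind]

lemma entropy_law_pure {α : Type*} [Fintype α] (D : DemandMatrix K N L) (f : s.Outcome → α) :
    entropy (s.law (PMF.pure D)) f = entropy s.baseLaw (fun p => f (s.outcome D p)) := by
  rw [law_pure, entropy_map]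

lemma entropy_library : entropy s.baseLaw (fun p => p.1) = N * B := by
  have h : s.baseLaw.map Prod.fst = PMF.uniformOfFintype (Library N B) := by
    simp only [baseLaw, PMF.map_bind, PMF.map_comp]
    simp only [Function.comp_def, PMF.bind_const]
    have h (F : Library N B) : s.randLaw.map (fun _ => F) = PMF.pure F := PMF.map_const _ F
    simp only [h, PMF.bind_pure]
  rw [← entropy_map s.baseLaw Prod.fst (fun F => F), h, entropy_uniformOfFintype]
  simp [← pow_mul, Real.logb_pow, mul_comm]

variable {s}

/-- With `f S` the joint entropy of the files in `S` and `Z_k`, decodability gives `f S ≤ H(X) +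
H(Z_k)` when `S` is demanded, while averaging gives a lower bound on `f S - H(Z_k)`. -/
lemma load_lower_bound (hN : 0 < N) (hLN : L ≤ N) (hB : 0 < B) (k : Fin K) {M R ε : ℝ}
    (hdec : s.Decodable) (hM : s.MemoryAtMost M) (hR : s.LoadAtMost R) (hε : s.MetadataAtMost ε) :
    L * (N - (M + ε)) ≤ N * (R + ε) := by
  set Z : Library N B × (∀ k, s.CacheMeta k) × s.Rand → s.CacheMeta k × s.Cache k :=
    fun p => (p.2.1 k, s.cacheContent k p.1 (p.2.1 k)) with hZ
  set f : Finset (Fin N) → ℝ := fun S =>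
    entropy s.baseLaw (fun p => (fun i : S => p.1 i, Z p)) with hf
  obtain ⟨S, hS, hSf⟩ := exists_card_eq_mul_sub_le hN hLN f fun T S i hTS =>
    entropy_insert_sub_le s.baseLaw (fun p => p.1) Z T S i hTS
  set D : DemandMatrix K N L := fun _ => ⟨S.orderEmbOfFin hS, (S.orderEmbOfFin hS).strictMono⟩
    with hD
  have huniv : N * B ≤ f Finset.univ := by
    rw [← s.entropy_library]
    refine entropy_le_of_determines _ _ _ fun p q hpq => ?_
    simp only [Prod.mk.injEq, funext_iff, Subtype.forall] at hpq
    exact funext fun i => funext (hpq.1 i (Finset.mem_univ i))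
  have hempty : entropy s.baseLaw Z ≤ f ∅ :=
    entropy_le_of_determines _ _ _ fun p q hpq => (Prod.ext_iff.1 hpq).2
  have hempty' : f ∅ ≤ entropy s.baseLaw Z :=
    entropy_le_of_determines _ _ _ fun p q hpq => Prod.ext (funext fun i => absurd i.2 (Finset.notMem_empty _)) hpq
  have hZle : entropy s.baseLaw Z ≤ ε * B + M * B := by
    refine (entropy_prod_le _ _ _).trans (add_le_add ?_ ?_)
    · have := (hε D).1 k
      rwa [entropy_law_pure] at this
    · have := hM D k
      rwa [entropy_law_pure] at this
  have hXle : entropy s.baseLaw (fun p => s.X (s.outcome D p)) ≤ ε * B + R * B := by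
    refine (entropy_prod_le _ _ _).trans (add_le_add ?_ ?_)
    · have := (hε D).2
      rwa [entropy_law_pure] at this
    · have := hR D
      rwa [entropy_law_pure] at this
  have hfS : f S ≤ entropy s.baseLaw (fun p => s.X (s.outcome D p)) + entropy s.baseLaw Z := by
    have h0 := hdec (PMF.pure D) k
    rw [condEntropy, entropy_law_pure, entropy_law_pure, sub_eq_zero] at h0
    calc f S ≤ entropy s.baseLaw (fun p => (s.requestedFiles k (s.outcome D p),
          (s.X (s.outcome D p), s.Z k (s.outcome D p), s.d k (s.outcome D p)))) := by
          refine entropy_le_of_determines _ _ _ fun p q hpq => ?_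
          simp only [Prod.mk.injEq] at hpq ⊢
          refine ⟨funext fun i => ?_, hpq.2.2.1⟩
          have hi : i.1 ∈ Set.range (S.orderEmbOfFin hS) := by
            rw [Finset.range_orderEmbOfFin]; exact i.2
          obtain ⟨l, hl⟩ := hi
          have := congrFun hpq.1 l
          rw [← hl]
          exact this
      _ = _ := h0
      _ ≤ entropy s.baseLaw (fun p => (s.X (s.outcome D p), Z p)) :=
          entropy_le_of_determines _ _ _ fun p q hpq => by
            simp only [Prod.mk.injEq] at hpq ⊢
            exact ⟨hpq.1, hpq.2, rfl⟩
      _ ≤ _ := entropy_prod_le _ _ _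
  have hB' : (0 : ℝ) < B := by exact_mod_cast hB
  have h1 : (N : ℝ) * (f S - f ∅) ≤ N * (ε * B + R * B) :=
    mul_le_mul_of_nonneg_left (by linarith) (Nat.cast_nonneg N)
  have h2 : (L : ℝ) * (N * B - (ε * B + M * B)) ≤ L * (f Finset.univ - f ∅) :=
    mul_le_mul_of_nonneg_left (by linarith) (Nat.cast_nonneg L)
  refine le_of_mul_le_mul_right ?_ hB'
  linarith

end Scheme

theorem le_of_achievable {K N L : ℕ} (hK : 0 < K) (hN : 0 < N) (hLN : L ≤ N) {M R : ℝ}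
    (h : Achievable K N L M R) : L * (1 - M / N) ≤ R := by
  have hN' : (0 : ℝ) < N := by exact_mod_cast hN
  have hc : (0 : ℝ) < N + L := by positivity
  have key : (L : ℝ) * (N - M) ≤ N * R := by
    refine le_of_forall_pos_le_add fun δ hδ => ?_
    -- Metadata cost `(N + L) ε` in the bound, here exactly `δ`; the threshold `1` ensures `B > 0`.
    obtain ⟨B, hB, s, hdec, -, hM, hR, hε⟩ := h (δ / (N + L)) (by positivity) 1
    have := Scheme.load_lower_bound hN hLN hB ⟨0, hK⟩ hdec hM hR hε
    have e : (N + L) * (δ / (N + L)) = δ := by field_simp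
    linarith
  refine le_of_mul_le_mul_left ?_ hN'
  calc (N : ℝ) * (L * (1 - M / N)) = L * (N - M) := by field_simp
    _ ≤ _ := key

end Converse

/-! ### The one-time-pad scheme: decodability and privacy. -/

section OneTimePad

variable {K N L B : ℕ} {𝔽 E : Type} [Field 𝔽]

/-- Whether file `n` is requested. -/
def requests (d : DemandVector N L) (n : Fin N) : Bool := decide (∃ l, d.1 l = n)

lemma requests_apply (d : DemandVector N L) (l : Fin L) : requests d (d.1 l) = true := by
  simp [requests]

lemma exists_of_requests {d : DemandVector N L} {n : Fin N} (h : requests d n = true) :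
    ∃ l, d.1 l = n := by
  simpa [requests] using h

/-- The part of a file stored by user `k`: with `x = (x₀, x₁, …, x_K)`, all `x_j` with `j ≠ k`,
`j ≥ 1`, together with `x₀ + w x_k`, where `w` is a bit. -/
def cachedPart (k : Fin K) (w : Bool) (x : 𝔽 × (Fin K → 𝔽)) : Fin K → 𝔽 :=
  Function.update x.2 k (x.1 + if w then x.2 k else 0)

/-- The combination `x₀ + ∑ₖ uₖ xₖ` of the pieces of a file. -/
def maskedSum (u : Fin K → Bool) (x : 𝔽 × (Fin K → 𝔽)) : 𝔽 :=
  x.1 + ∑ k, if u k then x.2 k else 0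

/-- Isolates what user `k` cannot compute: the middle term, which is `0` if `u k = w` and `± x_k`
otherwise. -/
lemma maskedSum_eq (k : Fin K) (w : Bool) (u : Fin K → Bool) (x : 𝔽 × (Fin K → 𝔽)) :
    maskedSum u x = cachedPart k w x k +
      ((if u k then x.2 k else 0) - if w then x.2 k else 0) +
      ∑ j ∈ Finset.univ.erase k, if u j then cachedPart k w x j else 0 := by
  have h : ∑ j ∈ Finset.univ.erase k, (if u j then cachedPart k w x j else 0) =
      ∑ j ∈ Finset.univ.erase k, if u j then x.2 j else 0 :=
    Finset.sum_congr rfl fun j hj => by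
      rw [cachedPart, Function.update_of_ne (Finset.ne_of_mem_erase hj)]
  rw [h, maskedSum, ← Finset.add_sum_erase _ _ (Finset.mem_univ k), cachedPart,
    Function.update_self]
  ring

/-- If the `k`-th coefficient is the bit of user `k`, the user knows the combination. -/
lemma maskedSum_congr {k : Fin K} {w : Bool} {u : Fin K → Bool} {x y : 𝔽 × (Fin K → 𝔽)}
    (h : cachedPart k w x = cachedPart k w y) (hu : u k = w) : maskedSum u x = maskedSum u y := by
  rw [maskedSum_eq k w u x, maskedSum_eq k w u y, h, hu]
  simp

/-- If the `k`-th coefficient is not the bit of user `k`, the combination completes its cache. -/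
lemma eq_of_maskedSum_eq {k : Fin K} {w : Bool} {u : Fin K → Bool} {x y : 𝔽 × (Fin K → 𝔽)}
    (h : cachedPart k w x = cachedPart k w y) (hu : u k = !w)
    (hs : maskedSum u x = maskedSum u y) : x = y := by
  rw [maskedSum_eq k w u x, maskedSum_eq k w u y, h, hu] at hs
  have hk : x.2 k = y.2 k := by cases w <;> simpa using hs
  have h0 := congrFun h k
  simp only [cachedPart, Function.update_self, hk] at h0
  refine Prod.ext (add_right_cancel h0) (funext fun j => ?_)
  by_cases hj : j = k
  · rw [hj, hk]
  · simpa [cachedPart, hj] using congrFun h j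

variable [Fintype 𝔽] [Fintype E] (φ : (Fin B → Bool) ≃ (𝔽 × (Fin K → 𝔽)) × E) (α : Fin N ↪ 𝔽)

/-- The scheme in which every file consists of `K + 1` symbols of a field, of which user `k`
does not know one dimension, determined by a private random bit, and of a part in `E` that is
cached by all users.  The server encrypts the demands with the random bits. -/
noncomputable def oneTimePadScheme (L : ℕ) : Scheme K N L B where
  CacheMeta _ := Fin N → Bool
  Cache _ := Fin N → (Fin K → 𝔽) × E
  Rand := Unit
  PacketMeta := Fin K → Fin N → Bool
  Payload := Fin L → 𝔽
  placementLaw := PMF.uniformOfFintype _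
  randLaw := PMF.pure ()
  cacheContent k F w n := (cachedPart k (w n) (φ (F n)).1, (φ (F n)).2)
  packetMeta D z _ k n := xor ((z k).1 n) (requests (D k) n)
  payload F u l := ∑ n, α n ^ (l : ℕ) * maskedSum (fun k => u k n) (φ (F n)).1

lemma oneTimePadScheme_decodable : (oneTimePadScheme φ α L).Decodable := by
  intro Q k
  refine condEntropy_eq_zero_of_determines _ _ _ fun ω ω' h => ?_
  simp only [Prod.mk.injEq] at h
  obtain ⟨hX, hZ, hd⟩ := h
  obtain ⟨F, m, T, D⟩ := ω
  obtain ⟨F', m', T', D'⟩ := ω'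
  have hd : D k = D' k := hd
  have hZ1 : m k = m' k := (Prod.ext_iff.1 hZ).1
  set u : Fin K → Fin N → Bool := fun k n => xor (m k n) (requests (D k) n) with hu
  have hMP : u = fun k n => xor (m' k n) (requests (D' k) n) := (Prod.ext_iff.1 hX).1
  have hP : ∀ l : Fin L, ∑ n, α n ^ (l : ℕ) * maskedSum (fun k => u k n) (φ (F n)).1 =
      ∑ n, α n ^ (l : ℕ) * maskedSum (fun k => u k n) (φ (F' n)).1 := fun l => by
    conv_rhs => rw [hMP]
    exact congrFun (Prod.ext_iff.1 hX).2 l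
  have hC : ∀ n, cachedPart k (m k n) (φ (F n)).1 = cachedPart k (m k n) (φ (F' n)).1 ∧
      (φ (F n)).2 = (φ (F' n)).2 := fun n => by
    have := congrFun (Prod.ext_iff.1 hZ).2 n
    rw [← Prod.mk.injEq]
    conv_rhs => rw [hZ1]
    exact this
  -- Differences of the masked sums in two outcomes that look alike to user `k`. They vanish at
  -- files not requested; at the `L` requested ones they solve a homogeneous Vandermonde system with
  -- distinct nodes, hence vanish too.
  set δ : Fin N → 𝔽 := fun n => maskedSum (fun k => u k n) (φ (F n)).1 -
    maskedSum (fun k => u k n) (φ (F' n)).1 with hδ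
  have hδ0 : ∀ n, n ∉ Finset.univ.map ⟨(D k).1, (D k).2.injective⟩ → δ n = 0 := by
    intro n hn
    have : requests (D k) n = false := by
      by_contra hr
      obtain ⟨l, hl⟩ := exists_of_requests (by simpa using hr)
      exact hn (Finset.mem_map.2 ⟨l, Finset.mem_univ l, hl⟩)
    exact sub_eq_zero.2 (maskedSum_congr (hC n).1 (by simp [hu, this]))
  have hδd : (fun l => δ ((D k).1 l)) = 0 := by
    refine Matrix.eq_zero_of_forall_pow_sum_mul_pow_eq_zero
      (f := fun l => α ((D k).1 l)) (α.injective.comp (D k).2.injective) fun i => ?_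
    have h1 := sub_eq_zero.2 (hP i)
    rw [← Finset.sum_sub_distrib, ← Finset.sum_subset (Finset.subset_univ
      (Finset.univ.map ⟨(D k).1, (D k).2.injective⟩)), Finset.sum_map] at h1
    · rw [← h1]
      refine Finset.sum_congr rfl fun l _ => ?_
      simp only [hδ, Function.Embedding.coeFn_mk]
      ring
    · intro n _ hn
      rw [← mul_sub]
      exact mul_eq_zero_of_right _ (hδ0 n hn)
  funext l
  change F ((D k).1 l) = F' ((D' k).1 l)
  rw [← hd]
  refine φ.injective (Prod.ext ?_ (hC _).2)
  exact eq_of_maskedSum_eq (hC _).1 (by simp [hu, requests_apply])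
    (sub_eq_zero.1 (congrFun hδd l))

/-- What user `k` with demand `d` sees, as a function of the library and the packet metadata. -/
noncomputable def userView (k : Fin K) (d : DemandVector N L)
    (p : Library N B × (Fin K → Fin N → Bool)) :
    ((oneTimePadScheme φ α L).PacketMeta × (oneTimePadScheme φ α L).Payload) ×
      ((oneTimePadScheme φ α L).CacheMeta k × (oneTimePadScheme φ α L).Cache k) :=
  ((p.2, (oneTimePadScheme φ α L).payload p.1 p.2),
    (fun n => xor (p.2 k n) (requests d n),
      (oneTimePadScheme φ α L).cacheContent k p.1 fun n => xor (p.2 k n) (requests d n)))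

lemma map_uniformOfFintype_equiv {β : Type*} [Fintype β] [Nonempty β] (e : β ≃ β) :
    (PMF.uniformOfFintype β).map e = PMF.uniformOfFintype β := by
  classical
  ext b
  rw [PMF.map_apply, tsum_eq_single (e.symm b)]
  · simp
  · intro c hc
    rw [if_neg]
    rintro rfl
    simp at hc

/-- The published bits are uniform and independent of the library, whatever `D` is. User `k`'s
secret bits are these bits unmasked by its own demand, so its whole view depends on `D` only through
`D k`. -/
lemma oneTimePadScheme_private : (oneTimePadScheme φ α L).Private := by
  intro Q k
  refine condMutualInfo_eq_zero_of_kernel _ _ _ _ Q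
    (fun D (j : {j : Fin K // j ≠ k}) => D j) (fun D => D k)
    (fun d => (PMF.uniformOfFintype (Library N B)).bind fun F =>
      (PMF.uniformOfFintype (Fin K → Fin N → Bool)).map fun u => userView φ α k d (F, u)) ?_
  set mask : DemandMatrix K N L → (Fin K → Fin N → Bool) ≃ (Fin K → Fin N → Bool) := fun D =>
    { toFun := fun m k n => xor (m k n) (requests (D k) n)
      invFun := fun m k n => xor (m k n) (requests (D k) n)
      left_inv := fun m => by simp
      right_inv := fun m => by simp } with hmask
  have hbase : ∀ {δ : Type} (g : Library N B × (Fin K → Fin N → Bool) × Unit → δ),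
      PMF.map g (oneTimePadScheme φ α L).baseLaw =
        (PMF.uniformOfFintype (Library N B)).bind fun F =>
          (PMF.uniformOfFintype (Fin K → Fin N → Bool)).map fun m => g (F, m, ()) := by
    intro δ g
    have h : (oneTimePadScheme φ α L).baseLaw = (PMF.uniformOfFintype (Library N B)).bind fun F =>
        (PMF.uniformOfFintype (Fin K → Fin N → Bool)).bind fun m =>
          (PMF.pure ()).map fun T => (F, m, T) := rfl
    rw [h]
    simp only [PMF.map_bind, PMF.pure_map]
    rfl
  rw [Scheme.law_eq_bind, PMF.map_bind]
  refine congrArg _ (funext fun D => ?_)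
  rw [PMF.map_comp, PMF.map_bind]
  refine (hbase _).trans (congrArg _ (funext fun F => ?_))
  -- For fixed `D`, masking is an involution, so a uniform published `u` may be written as the mask
  -- of uniform secret bits.
  conv_rhs => rw [← map_uniformOfFintype_equiv (mask D), PMF.map_comp, PMF.map_comp]
  refine congrArg (fun f => PMF.map f _) (funext fun m => ?_)
  have hm : m k = fun n => xor (mask D m k n) (requests (D k) n) := by
    funext n
    simp [hmask]
  simp only [Function.comp_apply, userView]
  rw [← hm]
  rfl

end OneTimePad

/-! ### Choice of parameters and achievability. -/

section Achievability

/-- If the bits of a file are divided into `K + 1` symbols of `b` bits and `e` further bits, then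
`K` symbols and the further bits of each file are cached, and `L` symbols are sent. -/
lemma exists_scheme (K N L : ℕ) {B b e : ℕ} (hB : B = (K + 1) * b + e) (hb : b ≠ 0)
    (hNb : N ≤ 2 ^ b) :
    ∃ s : Scheme K N L B, s.Decodable ∧ s.Private ∧
      (∀ D k, entropy (s.law (PMF.pure D)) (s.C k) ≤ N * (K * b + e)) ∧
      (∀ D, entropy (s.law (PMF.pure D)) s.P ≤ L * b) ∧
      ∀ D, (∀ k, entropy (s.law (PMF.pure D)) (fun ω => ω.cacheMeta k) ≤ N) ∧
        entropy (s.law (PMF.pure D)) s.MP ≤ K * N := by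
  classical
  have : Fact (Nat.Prime 2) := ⟨Nat.prime_two⟩
  let _ : Fintype (GaloisField 2 b) := Fintype.ofFinite _
  have hc : Fintype.card (GaloisField 2 b) = 2 ^ b := by
    rw [← Nat.card_eq_fintype_card, GaloisField.card 2 b hb]
  let φ : (Fin B → Bool) ≃
      (GaloisField 2 b × (Fin K → GaloisField 2 b)) × (Fin e → Bool) :=
    Fintype.equivOfCardEq (by simp [hc, hB]; ring)
  -- The Vandermonde nodes, one per file; this is where `N ≤ 2 ^ b` enters.
  obtain ⟨α⟩ : Nonempty (Fin N ↪ GaloisField 2 b) :=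
    Function.Embedding.nonempty_of_card_le (by simpa [hc] using hNb)
  have hlog (n : ℕ) : Real.logb 2 (((2 : ℕ) ^ n : ℕ) : ℝ) = n := by
    rw [Nat.cast_pow, Nat.cast_two, Real.logb_pow, Real.logb_self_eq_one one_lt_two, mul_one]
  refine ⟨oneTimePadScheme φ α L, oneTimePadScheme_decodable φ α, oneTimePadScheme_private φ α,
    fun D k => ?_, fun D => ?_, fun D => ⟨fun k => ?_, ?_⟩⟩
  · refine (entropy_le_logb_card _ _).trans (le_of_eq ?_)
    have h : Fintype.card ((oneTimePadScheme φ α L).Cache k) = 2 ^ (N * (K * b + e)) := by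
      change Fintype.card (Fin N → (Fin K → GaloisField 2 b) × (Fin e → Bool)) = _
      simp [hc]; ring
    rw [h, hlog]
    push_cast
    rfl
  · refine (entropy_le_logb_card _ _).trans (le_of_eq ?_)
    have h : Fintype.card (oneTimePadScheme φ α L).Payload = 2 ^ (L * b) := by
      change Fintype.card (Fin L → GaloisField 2 b) = _
      simp [hc]; ring
    rw [h, hlog]
    push_cast
    rfl
  · refine (entropy_le_logb_card _ _).trans (le_of_eq ?_)
    have h : Fintype.card ((oneTimePadScheme φ α L).CacheMeta k) = 2 ^ N := by
      change Fintype.card (Fin N → Bool) = _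
      simp
    rw [h, hlog]
  · refine (entropy_le_logb_card _ _).trans (le_of_eq ?_)
    have h : Fintype.card (oneTimePadScheme φ α L).PacketMeta = 2 ^ (K * N) := by
      change Fintype.card (Fin K → Fin N → Bool) = _
      simp; ring
    rw [h, hlog]
    push_cast
    rfl

theorem achievable_of_lt {K N L : ℕ} (hK : 1 ≤ K) (hN : 1 ≤ N) {M R : ℝ}
    (hM : (K : ℝ) / (K + 1) * N ≤ M) (hMN : M ≤ N) (hR : L * (1 - M / N) < R) :
    Achievable K N L M R := by
  intro ε hε B₀
  have hN' : (1 : ℝ) ≤ N := by exact_mod_cast hN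
  have hK' : (1 : ℝ) ≤ K := by exact_mod_cast hK
  have hN0 : (0 : ℝ) < N := by linarith
  set μ : ℝ := 1 - M / N with hμ
  have hMμ : M = N - N * μ := by rw [hμ]; field_simp; ring
  have hμ0 : 0 ≤ μ := sub_nonneg.2 ((div_le_one hN0).2 hMN)
  have hμ1 : μ * (K + 1) ≤ 1 := by
    have : (K : ℝ) / (K + 1) ≤ M / N := (le_div_iff₀ hN0).2 hM
    have h2 : μ ≤ 1 - K / (K + 1) := by linarith
    calc μ * (K + 1) ≤ (1 - (K : ℝ) / (K + 1)) * (K + 1) := by gcongr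
      _ = 1 := by field_simp; ring
  set δ : ℝ := R - L * μ with hδ
  have hδ0 : 0 < δ := sub_pos.2 hR
  -- Large enough that `B = (K + 1) q` absorbs the `K N` bits of packet metadata into `ε B` and the
  -- rounding loss `L N` into the slack `δ B`; the summand `N` gives `N ≤ q`.
  set q : ℕ := N + B₀ + ⌈K * N / ε⌉₊ + ⌈L * N / δ⌉₊ with hq
  set B : ℕ := (K + 1) * q with hBdef
  have hqB : q ≤ B := Nat.le_mul_of_pos_left q (Nat.succ_pos K)
  set b : ℕ := max ⌈μ * B⌉₊ N with hb
  have hbq : b ≤ q := by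
    refine max_le (Nat.ceil_le.2 ?_) (by omega)
    calc μ * B = μ * (K + 1) * q := by rw [hBdef]; push_cast; ring
      _ ≤ 1 * q := by gcongr
      _ = q := one_mul _
  have hμb : μ * B ≤ b := (Nat.le_ceil _).trans (by exact_mod_cast le_max_left _ _)
  have hεB : K * N ≤ ε * B := by
    rw [mul_comm ε, ← div_le_iff₀ hε]
    exact (Nat.le_ceil _).trans (Nat.cast_le.2 (by omega))
  have hδB : L * N ≤ δ * B := by
    rw [mul_comm δ, ← div_le_iff₀ hδ0]
    exact (Nat.le_ceil _).trans (Nat.cast_le.2 (by omega))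
  have hbL : (L : ℝ) * b ≤ R * B := by
    have hL0 : (0 : ℝ) ≤ L := Nat.cast_nonneg L
    have hR' : R = L * μ + δ := by rw [hδ]; ring
    have hb' : (b : ℝ) ≤ μ * B + N := by
      rw [hb, Nat.cast_max]
      refine max_le ?_ ?_
      · have := Nat.ceil_lt_add_one (mul_nonneg hμ0 (Nat.cast_nonneg B))
        linarith
      · have := mul_nonneg hμ0 (Nat.cast_nonneg (α := ℝ) B)
        linarith
    calc (L : ℝ) * b ≤ L * (μ * B + N) := by gcongr
      _ = L * μ * B + L * N := by ring
      _ ≤ L * μ * B + δ * B := by gcongr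
      _ = R * B := by rw [hR']; ring
  obtain ⟨e, he⟩ : ∃ e, B = (K + 1) * b + e :=
    Nat.exists_eq_add_of_le (Nat.mul_le_mul_left _ hbq)
  have hNb : N ≤ b := le_max_right _ _
  obtain ⟨s, hdec, hpriv, hC, hP, hmeta⟩ := exists_scheme K N L he (by omega)
    (hNb.trans Nat.lt_two_pow_self.le)
  have heR : (B : ℝ) = (K + 1) * b + e := by exact_mod_cast he
  refine ⟨B, by omega, s, hdec, hpriv, fun D k => (hC D k).trans ?_, fun D => (hP D).trans hbL,
    fun D => ⟨fun k => ((hmeta D).1 k).trans ?_, (hmeta D).2.trans hεB⟩⟩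
  · calc (N : ℝ) * (K * b + e) = N * (B - b) := by rw [heR]; ring
      _ ≤ N * (B - μ * B) := by gcongr
      _ = M * B := by rw [hMμ]; ring
  · nlinarith

end Achievability

/-! ### The last segment of the lower convex envelope. -/

section Envelope

/-- By Pascal's rule the second sum splits into partial sums of row `k` up to `t - 1` and up to `t`.
The former completes the tail to `2 ^ k`, the latter is at most `2 ^ k`. After clearing denominators
this is `le_mdsPoint`. -/
lemma sum_choose_add_le (k t : ℕ) (ht : t ≤ k + 1) :
    ∑ j ∈ Finset.Icc t k, k.choose j + ∑ j ∈ Finset.range (t + 1), (k + 1).choose j ≤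
      2 ^ (k + 1) := by
  have h1 : ∑ j ∈ Finset.range (t + 1), (k + 1).choose j =
      ∑ j ∈ Finset.range t, k.choose j + ∑ j ∈ Finset.range (t + 1), k.choose j := by
    rw [Finset.sum_range_succ', Finset.sum_range_succ' (fun j => k.choose j)]
    simp only [Nat.choose_succ_succ, Finset.sum_add_distrib, Nat.choose_zero_right]
    ring
  have h2 : ∑ j ∈ Finset.range t, k.choose j + ∑ j ∈ Finset.Icc t k, k.choose j = 2 ^ k := by
    rw [← Nat.sum_range_choose, ← Finset.sum_range_add_sum_Ico _ ht]
    rfl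
  have h3 : ∑ j ∈ Finset.range (t + 1), k.choose j ≤ 2 ^ k := by
    rw [← Nat.sum_range_choose]
    rcases ht.lt_or_eq with h | rfl
    · exact Finset.sum_le_sum_of_subset (Finset.range_mono h)
    · simp [Finset.sum_range_succ _ (k + 1)]
  rw [h1, pow_succ]
  omega

variable {K N L : ℕ}

lemma mdsPieces_pos (K t : ℕ) : 0 < mdsPieces K t := Nat.add_pos_left (by positivity) _

lemma le_mdsPoint (hK : 1 ≤ K) (hN : 1 ≤ N) {t : ℕ} (ht : t ≤ K) :
    (L : ℝ) * (1 - (mdsPoint K N L t).1 / N) ≤ (mdsPoint K N L t).2 := by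
  obtain ⟨k, rfl⟩ : ∃ k, K = k + 1 := ⟨K - 1, by omega⟩
  have hN' : (N : ℝ) ≠ 0 := by positivity
  have hD : (0 : ℝ) < mdsPieces (k + 1) t := by exact_mod_cast mdsPieces_pos _ t
  have h := sum_choose_add_le k t ht
  have h' : (∑ j ∈ Finset.Icc t k, (k.choose j : ℝ)) +
      ∑ j ∈ Finset.range (t + 1), ((k + 1).choose j : ℝ) ≤ 2 ^ (k + 1) := by exact_mod_cast h
  have e : (mdsPieces (k + 1) t : ℝ) = 2 ^ k + ∑ j ∈ Finset.Icc t k, (k.choose j : ℝ) := by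
    simp [mdsPieces]
  simp only [mdsPoint, Nat.add_sub_cancel]
  rw [mul_div_cancel_left₀ _ hN']
  refine mul_le_mul_of_nonneg_left ?_ (Nat.cast_nonneg L)
  rw [one_sub_div hD.ne']
  refine div_le_div_of_nonneg_right ?_ hD.le
  linarith

lemma le_of_mem_convexHull_mdsPoints (hK : 1 ≤ K) (hN : 1 ≤ N) (hLN : L ≤ N) {p : ℝ × ℝ}
    (hp : p ∈ convexHull ℝ (mdsPoints K N L)) : (L : ℝ) * (1 - p.1 / N) ≤ p.2 := by
  have hN' : (N : ℝ) ≠ 0 := by positivity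
  have hK' : (K : ℝ) ≠ 0 := by positivity
  have hconv : Convex ℝ {p : ℝ × ℝ | (L : ℝ) ≤ p.2 + L / N * p.1} := by
    refine convex_halfSpace_ge (f := fun p : ℝ × ℝ => p.2 + L / N * p.1) ⟨?_, ?_⟩ _
    · intro x y
      simp only [Prod.fst_add, Prod.snd_add]
      ring
    · intro c x
      simp only [Prod.smul_fst, Prod.smul_snd, smul_eq_mul]
      ring
  have hsub : mdsPoints K N L ⊆ {p : ℝ × ℝ | (L : ℝ) ≤ p.2 + L / N * p.1} := by
    rintro x ((rfl | ⟨t, ht, rfl⟩) | rfl)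
    · simpa using hLN
    · have := le_mdsPoint (L := L) hK hN ht
      rw [mul_sub, ← mul_div_assoc, ← div_mul_eq_mul_div] at this
      simp only [Set.mem_ofPred_eq]
      linarith
    · simp only [Set.mem_ofPred_eq]
      refine le_of_eq ?_
      field_simp
      ring
  have := convexHull_min hsub hconv hp
  simp only [Set.mem_ofPred_eq] at this
  rw [mul_sub, ← mul_div_assoc, ← div_mul_eq_mul_div]
  linarith

lemma mdsPoint_self (hK : 1 ≤ K) : mdsPoint K N L K = ((N : ℝ), 0) := by
  obtain ⟨k, rfl⟩ : ∃ k, K = k + 1 := ⟨K - 1, by omega⟩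
  have h : (∑ j ∈ Finset.range (k + 1 + 1), ((k + 1).choose j : ℝ)) = 2 ^ (k + 1) := by
    exact_mod_cast Nat.sum_range_choose (k + 1)
  have hD : mdsPieces (k + 1) (k + 1) = 2 ^ k := by simp [mdsPieces]
  simp only [mdsPoint, h, hD]
  simp

lemma mdsPoint_pred (hK : 1 ≤ K) : mdsPoint K N L (K - 1) =
    ((2 : ℝ) ^ (K - 1) / (2 ^ (K - 1) + 1) * N, (L : ℝ) * (1 / (2 ^ (K - 1) + 1))) := by
  obtain ⟨k, rfl⟩ : ∃ k, K = k + 1 := ⟨K - 1, by omega⟩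
  have h : (∑ j ∈ Finset.range (k + 1 + 1), ((k + 1).choose j : ℝ)) = 2 ^ (k + 1) := by
    exact_mod_cast Nat.sum_range_choose (k + 1)
  rw [Finset.sum_range_succ, Nat.choose_self, Nat.cast_one] at h
  have hD : mdsPieces (k + 1) k = 2 ^ k + 1 := by simp [mdsPieces]
  simp only [mdsPoint, Nat.add_sub_cancel, hD, ← h]
  rw [mul_comm (N : ℝ)]
  simp

lemma mem_convexHull_of_le {S : Set (ℝ × ℝ)} {n l x M : ℝ} (hn : 0 < n)
    (hx : (x, l * (1 - x / n)) ∈ S) (hS : (n, 0) ∈ S) (hxM : x ≤ M) (hMn : M ≤ n) :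
    (M, l * (1 - M / n)) ∈ convexHull ℝ S := by
  -- If `x = n` the segment degenerates and its weights would have denominator zero.
  rcases (hxM.trans hMn).eq_or_lt with rfl | hlt
  · obtain rfl := le_antisymm hxM hMn
    exact subset_convexHull ℝ S hx
  · have hpos : 0 < n - x := sub_pos.2 hlt
    have hseg : (M, l * (1 - M / n)) ∈ segment ℝ (x, l * (1 - x / n)) (n, 0) := by
      refine ⟨(n - M) / (n - x), (M - x) / (n - x), div_nonneg (sub_nonneg.2 hMn) hpos.le,
        div_nonneg (sub_nonneg.2 hxM) hpos.le, ?_, ?_⟩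
      · field_simp
        ring
      · ext
        · simp only [Prod.smul_mk, Prod.mk_add_mk, smul_eq_mul]
          field_simp
          ring
        · simp only [Prod.smul_mk, Prod.mk_add_mk, smul_eq_mul]
          field_simp
          ring
    exact segment_subset_convexHull hx hS hseg

theorem mdsLoad_eq (hK : 1 ≤ K) (hN : 1 ≤ N) (hLN : L ≤ N) {M : ℝ}
    (hM : min ((2 * (K : ℝ) - 1) / (2 * (K : ℝ)))
        ((2 : ℝ) ^ (K - 1) / ((2 : ℝ) ^ (K - 1) + 1)) * (N : ℝ) ≤ M) (hMN : M ≤ (N : ℝ)) :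
    mdsLoad K N L M = (L : ℝ) * (1 - M / N) := by
  have hN' : (0 : ℝ) < N := by positivity
  have hK' : (K : ℝ) ≠ 0 := by positivity
  have hS : ((N : ℝ), (0 : ℝ)) ∈ mdsPoints K N L :=
    Or.inl (Or.inr ⟨K, le_rfl, (mdsPoint_self hK).symm⟩)
  have hmem : (M, (L : ℝ) * (1 - M / N)) ∈ convexHull ℝ (mdsPoints K N L) := by
    rcases min_cases ((2 * (K : ℝ) - 1) / (2 * (K : ℝ)))
      ((2 : ℝ) ^ (K - 1) / ((2 : ℝ) ^ (K - 1) + 1)) with ⟨h, -⟩ | ⟨h, -⟩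
    · rw [h] at hM
      refine mem_convexHull_of_le hN' (Or.inr ?_) hS hM hMN
      rw [Set.mem_singleton_iff, mul_div_assoc, div_self hN'.ne', Prod.mk.injEq]
      refine ⟨rfl, ?_⟩
      field_simp
      ring
    · rw [h] at hM
      refine mem_convexHull_of_le hN' (Or.inl (Or.inr ⟨K - 1, by omega, ?_⟩)) hS hM hMN
      rw [mdsPoint_pred hK, mul_div_assoc, div_self hN'.ne', Prod.mk.injEq]
      refine ⟨rfl, ?_⟩
      field_simp
      ring
  exact IsLeast.csInf_eq ⟨hmem, fun y hy => le_of_mem_convexHull_mdsPoints hK hN hLN hy⟩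

end Envelope

/-- The one-time-pad scheme covers the whole memory range of the theorem; the second comparison
amounts to `K ≤ 2 ^ (K - 1)`. -/
lemma div_add_one_le_min {K : ℕ} (hK : 1 ≤ K) : (K : ℝ) / (K + 1) ≤
    min ((2 * (K : ℝ) - 1) / (2 * (K : ℝ))) ((2 : ℝ) ^ (K - 1) / ((2 : ℝ) ^ (K - 1) + 1)) := by
  have hK' : (1 : ℝ) ≤ K := by exact_mod_cast hK
  refine le_min ?_ ?_
  · rw [div_le_div_iff₀ (by positivity) (by positivity)]
    nlinarith
  · have h : (K : ℝ) ≤ 2 ^ (K - 1) := by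
      have : K - 1 < 2 ^ (K - 1) := Nat.lt_two_pow_self
      exact_mod_cast (show K ≤ 2 ^ (K - 1) by omega)
    rw [div_le_div_iff₀ (by positivity) (by positivity)]
    linarith

end PrivateCaching

theorem theorem6 (K N L : ℕ) (hK : 1 ≤ K) (hL : 1 ≤ L) (hLN : L ≤ N) (M : ℝ)
    (hM : min ((2 * (K : ℝ) - 1) / (2 * (K : ℝ)))
        ((2 : ℝ) ^ (K - 1) / ((2 : ℝ) ^ (K - 1) + 1)) * (N : ℝ) ≤ M)
    (hMN : M ≤ (N : ℝ)) :
    IsGLB {R : ℝ | PrivateCaching.Achievable K N L M R}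
        (PrivateCaching.optimalLoad K N L M) ∧
      PrivateCaching.optimalLoad K N L M = PrivateCaching.mdsLoad K N L M ∧
      PrivateCaching.mdsLoad K N L M = (L : ℝ) * (1 - M / (N : ℝ)) := by
  have hN : 1 ≤ N := hL.trans hLN
  have hM' : (K : ℝ) / (K + 1) * N ≤ M :=
    (mul_le_mul_of_nonneg_right (PrivateCaching.div_add_one_le_min hK) (Nat.cast_nonneg N)).trans hM
  have hach : ∀ R, (L : ℝ) * (1 - M / N) < R → PrivateCaching.Achievable K N L M R :=
    fun R hR => PrivateCaching.achievable_of_lt hK hN hM' hMN hR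
  -- Achievability is available for every load strictly above the line, which by density suffices
  -- for the infimum.
  have hglb : IsGLB {R : ℝ | PrivateCaching.Achievable K N L M R} (L * (1 - M / N)) :=
    ⟨fun R hR => PrivateCaching.le_of_achievable hK hN hLN hR,
      fun x hx => le_of_forall_gt_imp_ge_of_dense fun R hR => hx (hach R hR)⟩
  have hopt : PrivateCaching.optimalLoad K N L M = L * (1 - M / N) :=
    hglb.csInf_eq ⟨_, hach _ (lt_add_one _)⟩
  have hmds := PrivateCaching.mdsLoad_eq hK hN hLN hM hMN
  exact ⟨hopt ▸ hglb, hopt.trans hmds.symm, hmds⟩
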